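/- For a word $\pi=\pi_1\pi_2\cdots\pi_r$ of positive integers, let $\mathrm{asc}(\pi)$ be the number of $i\in\{0,\dots,r-1\}$ such that $i=0$ or $\pi_i<\pi_{i+1}$, let $\mathrm{des}(\pi)$ be the number of $i\in\{1,\dots,r\}$ such that $i=r$ or $\pi_i>\pi_{i+1}$, and let $\mathrm{plat}(\pi)$ be the number of $i\in\{1,\dots,r-1\}$ such that $\pi_i=\pi_{i+1}$. A $k$-quasi-Stirling permutation of size $n$ is a permutation of the multiset $\{1^k,2^k,\dots,n^k\}$ ($k$ copies of each of $1,\dots,n$) that avoids the patterns $1212$ and $2121$, i.e. has no subsequence whose entries are in the same relative order as $1212$ or $2121$. Let $\overline{\mathcal Q}^k_n$ be the set of these, let $\mathcal S_n$ be the set of permutations of $\{1,\dots,n\}$ in one-line notation, and put $$\overline P^{(k)}_n(q,t,u)=\sum_{\pi\in\overline{\mathcal Q}^k_n}q^{\mathrm{asc}(\pi)}t^{\mathrm{des}(\pi)}u^{\mathrm{plat}(\pi)},\qquad \overline P^{(k)}(q,t,u;z)=\sum_{n\ge0}\overline P^{(k)}_n(q,t,u)\frac{z^n}{n!},$$ $$\hat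 A_n(q,t)=\sum_{\pi\in\mathcal S_n}q^{\mathrm{asc}(\pi)}t^{\mathrm{des}(\pi)},\qquad \hat A(q,t;z)=\sum_{n\ge0}\hat A_n(q,t)\frac{z^n}{n!}.$$ **Theorem.** Fix $k\ge1$. As formal power series in $z$, $\overline P:=\overline P^{(k)}(q,t,u;z)$ satisfies $$\overline P=\hat A\bigl(q,t;\,z(\overline P-1+u)^{k-1}\bigr),$$ that is, over the field $\mathbb Q(q,t,u)$, $$\overline P=1-q+\frac{q(q-t)}{q-t\exp\bigl((q-t)z(\overline P-1+u)^{k-1}\bigr)}.$$ Moreover, for all $n\ge1$, $$\overline P^{(k)}_n(q,t,u)=\frac{n!}{(k-1)n+1}\,[z^n]\bigl(\hat A(q,t;z)-1+u\bigr)^{(k-1)n+1},$$ where $[z^n]F(z)$ denotes the coefficient of $z^n$ in $F(z)$. -/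

import Mathlib

namespace QuasiStirling

/-- The entry `π_i` of the word `π = π_1 π_2 … π_r`, numbered from `1`
(only used for `1 ≤ i ≤ r`). -/
def entry (π : List ℕ) (i : ℕ) : ℕ := π.getD (i - 1) 0

/-- Number of ascents: indices `i ∈ {0, …, r - 1}` with `i = 0` or `π_i < π_{i+1}`. -/
def asc (π : List ℕ) : ℕ :=
  ((Finset.range π.length).filter fun i => i = 0 ∨ entry π i < entry π (i + 1)).card

/-- Number of descents: indices `i ∈ {1, …, r}` with `i = r` or `π_i > π_{i+1}`. -/
def des (π : List ℕ) : ℕ :=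
  ((Finset.Icc 1 π.length).filter fun i => i = π.length ∨ entry π i > entry π (i + 1)).card

/-- Number of plateaus: indices `i ∈ {1, …, r - 1}` with `π_i = π_{i+1}`. -/
def plat (π : List ℕ) : ℕ :=
  ((Finset.Icc 1 (π.length - 1)).filter fun i => entry π i = entry π (i + 1)).card

/-- The words `τ` and `σ` have the same length and their entries are in the same relative order
(equal entries in one correspond to equal entries in the other). -/
def SameRelativeOrder (τ σ : List ℕ) : Prop :=
  ∃ h : τ.length = σ.length, ∀ i j : Fin τ.length,
    τ.get i < τ.get j ↔ σ.get (i.cast h) < σ.get (j.cast h)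

instance (τ σ : List ℕ) : Decidable (SameRelativeOrder τ σ) := by
  unfold SameRelativeOrder; infer_instance

/-- `π` avoids the pattern `σ`: no subsequence of `π` is in the same relative order as `σ`. -/
def Avoids (π σ : List ℕ) : Prop :=
  ∀ τ : List ℕ, τ.Sublist π → ¬ SameRelativeOrder τ σ

instance (π σ : List ℕ) : Decidable (Avoids π σ) :=
  decidable_of_iff (∀ τ ∈ π.sublists, ¬ SameRelativeOrder τ σ) (by simp [Avoids])

/-- The permutations of `[n] = {1, …, n}`, in one-line notation. -/
def perms (n : ℕ) : Finset (List ℕ) := (Finset.Icc 1 n).val.lists.toFinset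

/-- The `k`-quasi-Stirling permutations: the words that are permutations of the multiset
`{1^k, 2^k, …, n^k}` and avoid `1212` and `2121`. -/
def quasiStirling (k n : ℕ) : Finset (List ℕ) :=
  (k • (Finset.Icc 1 n).val).lists.toFinset.filter fun π =>
    Avoids π [1, 2, 1, 2] ∧ Avoids π [2, 1, 2, 1]

/-- The polynomial ring `ℚ[q, t, u]`. -/
abbrev Poly : Type := MvPolynomial (Fin 3) ℚ

noncomputable section

/-- The variable `q`, marking ascents. -/
def q : Poly := MvPolynomial.X 0

/-- The variable `t`, marking descents. -/
def t : Poly := MvPolynomial.X 1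

/-- The variable `u`, marking plateaus. -/
def u : Poly := MvPolynomial.X 2

/-- The exponential generating function `∑ a_n z^n / n!` of a sequence of polynomials. -/
def egf (a : ℕ → Poly) : PowerSeries Poly :=
  PowerSeries.mk fun n => (1 / (n.factorial : ℚ)) • a n

/-- The homogenized Eulerian polynomial. -/
def eulerianHat (n : ℕ) : Poly := ∑ π ∈ perms n, q ^ asc π * t ^ des π

/-- The exponential generating function of the homogenized Eulerian polynomials. -/
def Ahat : PowerSeries Poly := egf eulerianHat

/-- The refined `k`-quasi-Stirling polynomial. -/
def quasiStirlingPoly (k n : ℕ) : Poly :=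
  ∑ π ∈ quasiStirling k n, q ^ asc π * t ^ des π * u ^ plat π

/-- The exponential generating function of the refined `k`-quasi-Stirling polynomials. -/
def Pbar (k : ℕ) : PowerSeries Poly := egf (quasiStirlingPoly k)

/-- The field `ℚ(q, t, u)` of rational functions. -/
abbrev RatFun : Type := FractionRing Poly

/-- A polynomial regarded as a constant power series over `ℚ(q, t, u)`. -/
def const (p : Poly) : PowerSeries RatFun := PowerSeries.C (algebraMap Poly RatFun p)

/-- The series `Pbar k` regarded as a power series over `ℚ(q, t, u)`. -/
def PbarRat (k : ℕ) : PowerSeries RatFun := PowerSeries.map (algebraMap Poly RatFun) (Pbar k)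

end

end QuasiStirling

/-! Place a word between two letters `c` and `b`, and let neighbours `x`, `y` contribute `q`, `t` or
`u` according as `x < y`, `x > y` or `x = y`. Between two zeros a nonempty word of positive letters
has weight `q^asc t^des u^plat`, while the empty word has weight `u`. Hence F = P - 1 + u and Φ = A
- 1 + u are the generating functions of these weights over noncrossing words and over permutations.

A noncrossing word beginning with `a` has the form a v₁ a v₂ … v_{k-1} a w, where the vᵢ and w are
noncrossing on disjoint sets of letters (`noncrossing_append`). Thus a noncrossing word is a
permutation of its outer letters, those not enclosed by copies of another letter, in which every
letter carries k - 1 blocks, each between two copies of it. This gives F = Φ(z F^(k-1))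
(`wordSum_eq_sum`, `egf_stirlingSum_eq_subst`), provided that the total weight of the blocks between
two copies of `c` depends only on the number of letters used.

For permutations this is `wordSum_one_cyclic`: close the word into a circle, read it from its
minimum and cut it at its maximum; the resulting recursion involves sizes only. `wordSum_cyclic`
extends it to all k ≥ 1 by induction on the size.

The same cut yields the Riccati equation A' = (A - 1 + t)(A - 1 + q), whose solution is the explicit
form of A. Lagrange inversion applied to F = Φ(z F^(k-1)) gives the coefficients. -/

namespace QuasiStirling

/-! ### Noncrossing words and pattern avoidance -/

/-- A word is noncrossing if it has no subsequence `a b a b` with `a ≠ b`. -/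
def Noncrossing (w : List ℕ) : Prop := ∀ a b : ℕ, a ≠ b → ¬ [a, b, a, b].Sublist w

lemma Noncrossing.sublist {v w : List ℕ} (hw : Noncrossing w) (h : v.Sublist w) :
    Noncrossing v := fun a b hab hs => hw a b hab (hs.trans h)

lemma sameRelativeOrder_of_lt {a b : ℕ} (h : a < b) :
    SameRelativeOrder [a, b, a, b] [1, 2, 1, 2] ∧ SameRelativeOrder [b, a, b, a] [2, 1, 2, 1] := by
  refine ⟨⟨rfl, ?_⟩, ⟨rfl, ?_⟩⟩ <;> intro i j <;> fin_cases i <;> fin_cases j <;> simp <;> omega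

lemma eq_of_sameRelativeOrder {τ : List ℕ} {x y : ℕ} (hxy : x ≠ y)
    (h : SameRelativeOrder τ [x, y, x, y]) : ∃ a b, a ≠ b ∧ τ = [a, b, a, b] := by
  obtain ⟨hl, h⟩ := h
  match τ, hl with
  | [a, b, c, d], _ =>
    have h01 := h ⟨0, by simp⟩ ⟨1, by simp⟩
    have h10 := h ⟨1, by simp⟩ ⟨0, by simp⟩
    have h02 := h ⟨0, by simp⟩ ⟨2, by simp⟩
    have h20 := h ⟨2, by simp⟩ ⟨0, by simp⟩
    have h13 := h ⟨1, by simp⟩ ⟨3, by simp⟩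
    have h31 := h ⟨3, by simp⟩ ⟨1, by simp⟩
    simp at h01 h10 h02 h20 h13 h31
    have hac : c = a := by omega
    have hbd : d = b := by omega
    subst hac hbd
    exact ⟨c, d, by omega, rfl⟩

lemma avoids_iff_noncrossing (π : List ℕ) :
    Avoids π [1, 2, 1, 2] ∧ Avoids π [2, 1, 2, 1] ↔ Noncrossing π := by
  constructor
  · rintro ⟨h₁, h₂⟩ a b hab hs
    rcases hab.lt_or_gt with h | h
    · exact h₁ _ hs (sameRelativeOrder_of_lt h).1
    · exact h₂ _ hs (sameRelativeOrder_of_lt h).2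
  · refine fun h => ⟨fun τ hs ho => ?_, fun τ hs ho => ?_⟩ <;>
    · obtain ⟨a, b, hab, rfl⟩ := eq_of_sameRelativeOrder (by decide) ho
      exact h a b hab hs

lemma Noncrossing.of_nodup {w : List ℕ} (h : w.Nodup) : Noncrossing w := by
  intro a b _ hs
  simpa using h.sublist hs

/-- A crossing uses each of its two letters twice, so a letter occurring once takes part in none. -/
lemma noncrossing_cons_of_notMem {a : ℕ} {v : List ℕ} (ha : a ∉ v) :
    Noncrossing (a :: v) ↔ Noncrossing v := by
  refine ⟨fun h => h.sublist (List.sublist_cons_self _ _), fun h x y hxy hs => ?_⟩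
  rcases List.sublist_cons_iff.1 hs with hs | ⟨r, hr, hs⟩
  · exact h x y hxy hs
  · simp only [List.cons.injEq] at hr
    obtain ⟨rfl, rfl⟩ := hr
    exact ha (hs.subset (by simp))

lemma mem_of_sublist_append {x y : ℕ} {v w : List ℕ} (hx : x ∉ w)
    (h : [x, y, x].Sublist (v ++ w)) : [x, y, x].Sublist v := by
  obtain ⟨l₁, l₂, he, h₁, h₂⟩ := List.sublist_append_iff.1 h
  rcases List.eq_nil_or_concat l₂ with rfl | ⟨l, z, rfl⟩
  · rw [he]; simp [h₁]
  · have hz : z = x := by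
      have := congrArg List.getLast? he
      simpa using this.symm
    subst hz
    exact absurd (h₂.subset (by simp)) hx

/-- If a crossing involves a letter of `v`, the other letter appears between two copies of it and
hence also lies in `v`. So a crossing lives either inside `v` or inside what remains after `v` is
deleted, namely `a a w`. -/
lemma noncrossing_append {a : ℕ} {v w : List ℕ} (hav : a ∉ v) (hvw : ∀ x ∈ v, x ∉ w) :
    Noncrossing (a :: (v ++ a :: w)) ↔ Noncrossing v ∧ Noncrossing (a :: w) := by
  refine ⟨fun h => ⟨h.sublist ?_, h.sublist ?_⟩, ?_⟩
  · exact ((List.sublist_append_left _ _).trans (List.sublist_cons_self _ _))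
  · exact ((List.sublist_append_right _ _).trans (List.sublist_cons_self _ _))
  rintro ⟨hv, hw⟩ x y hxy hs
  have key : ∀ x y, x ≠ y → x ∈ v → [x, y, x].Sublist (a :: (v ++ a :: w)) → y ∈ v := by
    intro x y hxy hx hs
    have hxa : x ≠ a := fun h => hav (h ▸ hx)
    have h' : [x, y, x].Sublist (v ++ a :: w) := by
      rcases List.sublist_cons_iff.1 hs with hs | ⟨r, hr, hs⟩
      · exact hs
      · simp only [List.cons.injEq] at hr
        exact absurd hr.1 hxa
    exact (mem_of_sublist_append (by simp [hxa, hvw x hx]) h').subset (by simp)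
  have hxyx : [x, y, x].Sublist (a :: (v ++ a :: w)) :=
    List.Sublist.trans (by exact List.sublist_append_left [x, y, x] [y]) hs
  have hyxy : [y, x, y].Sublist (a :: (v ++ a :: w)) :=
    List.Sublist.trans (List.sublist_cons_self _ _) hs
  have hmem : x ∈ v ↔ y ∈ v := ⟨fun h => key x y hxy h hxyx, fun h => key y x hxy.symm h hyxy⟩
  by_cases hx : x ∈ v
  · have hf := hs.filter (fun z => decide (z ∈ v))
    have h1 : List.filter (fun z => decide (z ∈ v)) v = v := by simp
    have h2 : List.filter (fun z => decide (z ∈ v)) w = [] := by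
      simp only [List.filter_eq_nil_iff, decide_eq_true_eq]
      exact fun z hz hzv => hvw z hzv hz
    simp only [List.filter_cons, List.filter_append, h1, h2, hav, hx, hmem.1 hx] at hf
    exact hv x y hxy (by simpa using hf)
  · have hf := hs.filter (fun z => decide (z ∉ v))
    have h1 : List.filter (fun z => decide (z ∉ v)) v = [] := by simp
    have h2 : List.filter (fun z => decide (z ∉ v)) w = w := by
      simp only [List.filter_eq_self, decide_eq_true_eq]
      exact fun z hz hzv => hvw z hzv hz
    have hy : y ∉ v := fun h => hx (hmem.2 h)
    simp only [List.filter_cons, List.filter_append, h1, h2, hav, hx, hy] at hf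
    simp only [not_false_eq_true, decide_true, if_true, List.nil_append, List.filter_nil] at hf
    -- The pattern now sits in `a :: a :: w`; its first two letters differ, so it needs at most one
    -- of the two leading copies of `a`.
    rcases List.sublist_cons_iff.1 hf with hf | ⟨r, hr, hf⟩
    · exact hw x y hxy hf
    · simp only [List.cons.injEq] at hr
      obtain ⟨rfl, rfl⟩ := hr
      rcases List.sublist_cons_iff.1 hf with hf | ⟨r, hr, hf⟩
      · exact hw x y hxy (hf.cons_cons x)
      · simp only [List.cons.injEq] at hr
        exact hxy hr.1.symm

lemma append_cons_inj_of_first_occurrence {a : ℕ} {v v' w w' : List ℕ} (hv : a ∉ v)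
    (hv' : a ∉ v') (h : v ++ a :: w = v' ++ a :: w') : v = v' ∧ w = w' := by
  induction v generalizing v' with
  | nil =>
    cases v' with
    | nil => simpa using h
    | cons y v' => simp at h hv'; exact absurd h.1 hv'.1
  | cons x v ih =>
    cases v' with
    | nil => simp at h hv; exact absurd h.1.symm hv.1
    | cons y v' =>
      simp only [List.mem_cons, not_or, List.cons_append, List.cons.injEq] at h hv hv' ⊢
      obtain ⟨h1, h2⟩ := ih hv.2 hv'.2 h.2
      exact ⟨⟨h.1, h1⟩, h2⟩

/-! ### Words with prescribed letters, and cutting them at a repeated letter -/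

open Classical in
/-- The noncrossing words in which each element of `S` occurs `k` times. -/
noncomputable def words (k : ℕ) (S : Finset ℕ) : Finset (List ℕ) :=
  (k • S.val).lists.toFinset.filter Noncrossing

open Classical in
/-- The words which continue a noncrossing word that begins with `a`, such that `a` still has to
occur `j` times and each element of `S` has to occur `k` times. -/
noncomputable def tails (k a j : ℕ) (S : Finset ℕ) : Finset (List ℕ) :=
  (k • S.val + Multiset.replicate j a).lists.toFinset.filter fun v => Noncrossing (a :: v)

lemma mem_words {k : ℕ} {S : Finset ℕ} {w : List ℕ} :
    w ∈ words k S ↔ (w : Multiset ℕ) = k • S.val ∧ Noncrossing w := by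
  simp [words, eq_comm]

lemma mem_tails {k a j : ℕ} {S : Finset ℕ} {v : List ℕ} :
    v ∈ tails k a j S ↔
      (v : Multiset ℕ) = k • S.val + Multiset.replicate j a ∧ Noncrossing (a :: v) := by
  simp [tails, eq_comm]

lemma mem_of_mem_words {k : ℕ} {S : Finset ℕ} {w : List ℕ} (hw : w ∈ words k S) {x : ℕ}
    (hx : x ∈ w) : x ∈ S := by
  have h : x ∈ (w : Multiset ℕ) := hx
  rw [(mem_words.1 hw).1] at h
  exact Multiset.mem_of_mem_nsmul h

lemma words_empty (k : ℕ) : words k ∅ = {[]} := by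
  ext w
  rw [mem_words, Finset.mem_singleton]
  constructor
  · rintro ⟨h, -⟩
    simpa using h
  · rintro rfl
    exact ⟨by simp, Noncrossing.of_nodup List.nodup_nil⟩

lemma tails_zero {k a : ℕ} {S : Finset ℕ} (ha : a ∉ S) : tails k a 0 S = words k S := by
  ext v
  rw [mem_tails, mem_words, Multiset.replicate_zero, add_zero]
  refine and_congr_right fun h => noncrossing_cons_of_notMem fun hv => ha ?_
  have h' : a ∈ (v : Multiset ℕ) := hv
  rw [h] at h'
  exact Multiset.mem_of_mem_nsmul h'

lemma count_nsmul_val (k x : ℕ) (S : Finset ℕ) :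
    Multiset.count x (k • S.val) = if x ∈ S then k else 0 := by
  rw [Multiset.count_nsmul, Multiset.count_eq_of_nodup S.nodup]
  simp

lemma cons_mem_words {r a : ℕ} {S : Finset ℕ} {v : List ℕ} :
    a :: v ∈ words (r + 1) S ↔ a ∈ S ∧ v ∈ tails (r + 1) a r (S.erase a) := by
  by_cases ha : a ∈ S
  · simp only [ha, true_and, mem_words, mem_tails]
    refine and_congr_left fun _ => ?_
    rw [← Multiset.cons_coe]
    have : (r + 1) • S.val =
        a ::ₘ ((r + 1) • (S.erase a).val + Multiset.replicate r a) := by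
      ext x
      rw [Multiset.count_cons, Multiset.count_add, count_nsmul_val, count_nsmul_val,
        Multiset.count_replicate]
      by_cases hx : x = a
      · subst hx; simp [ha]
      · simp [hx, Ne.symm hx]
    rw [this, Multiset.cons_inj_right]
  · simp only [ha, false_and, iff_false]
    exact fun h => ha (mem_of_mem_words h (by simp))

lemma append_mem_tails {k a j : ℕ} {S T : Finset ℕ} {v w : List ℕ} (ha : a ∉ S) (hT : T ⊆ S)
    (hv : v ∈ words k T) (hw : w ∈ tails k a j (S \ T)) : v ++ a :: w ∈ tails k a (j + 1) S := by
  have hav : a ∉ v := fun h => ha (hT (mem_of_mem_words hv h))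
  have hvw : ∀ x ∈ v, x ∉ w := by
    intro x hx hxw
    have h' : x ∈ (w : Multiset ℕ) := hxw
    rw [(mem_tails.1 hw).1, Multiset.mem_add] at h'
    rcases h' with h' | h'
    · exact (Finset.mem_sdiff.1 (Finset.mem_def.2 (Multiset.mem_of_mem_nsmul h'))).2
        (mem_of_mem_words hv hx)
    · rw [Multiset.eq_of_mem_replicate h'] at hx
      exact hav hx
  rw [mem_tails, noncrossing_append hav hvw]
  refine ⟨?_, (mem_words.1 hv).2, (mem_tails.1 hw).2⟩
  rw [← Multiset.coe_add, ← Multiset.cons_coe, (mem_words.1 hv).1, (mem_tails.1 hw).1]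
  ext x
  simp only [Multiset.count_add, Multiset.count_cons, count_nsmul_val, Multiset.count_replicate,
    Finset.mem_sdiff]
  by_cases hx : x = a
  · subst hx
    have hxT : x ∉ T := fun h => ha (hT h)
    simp [ha, hxT]
  · by_cases hxT : x ∈ T
    · simp [hx, hxT, hT hxT, Ne.symm hx]
    · simp [hx, hxT, Ne.symm hx]

/-- Cut at the next `a`. A letter on both sides of the cut would cross with `a`, so the block before
the cut contains all `k` copies of each of its letters. -/
lemma exists_of_mem_tails {k a j : ℕ} {S : Finset ℕ} {x : List ℕ} (ha : a ∉ S)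
    (hx : x ∈ tails k a (j + 1) S) :
    ∃ T ⊆ S, ∃ v ∈ words k T, ∃ w ∈ tails k a j (S \ T), v ++ a :: w = x := by
  rw [mem_tails] at hx
  obtain ⟨hm, hn⟩ := hx
  have hax : a ∈ x := by
    have : a ∈ (x : Multiset ℕ) := by rw [hm]; simp
    exact this
  obtain ⟨v, w, rfl, hav⟩ := List.eq_append_cons_of_mem hax
  have hvw : ∀ y ∈ v, y ∉ w := by
    intro y hy hyw
    -- The crossing is `a y a y`, whose first `a` is the letter in front of the tail.
    refine hn a y (fun h => hav (h ▸ hy)) ?_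
    refine List.Sublist.cons_cons a ?_
    exact List.Sublist.append (List.singleton_sublist.2 hy)
      (List.Sublist.cons_cons a (List.singleton_sublist.2 hyw))
  have hc : ∀ y, v.count y + (if y = a then w.count y + 1 else w.count y) =
      (if y ∈ S then k else 0) + if y = a then j + 1 else 0 := by
    intro y
    have := congrArg (Multiset.count y) hm
    rw [Multiset.count_add, count_nsmul_val, Multiset.count_replicate] at this
    simp only [Multiset.coe_count, List.count_append, List.count_cons] at this
    by_cases hy : y = a
    · subst hy; simpa using this
    · simpa [hy, Ne.symm hy] using this
  have hvS : ∀ y ∈ v, y ∈ S := by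
    intro y hy
    by_contra hyS
    have hya : y ≠ a := fun h => hav (h ▸ hy)
    have := hc y
    have h1 := List.count_pos_iff.2 hy
    simp [hya, hyS] at this
    omega
  obtain ⟨hnv, hnw⟩ := (noncrossing_append hav hvw).1 hn
  refine ⟨v.toFinset, fun y hy => hvS y (by simpa using hy), v, mem_words.2 ⟨?_, hnv⟩, w,
    mem_tails.2 ⟨?_, hnw⟩, rfl⟩
  · ext y
    rw [count_nsmul_val, Multiset.coe_count]
    by_cases hy : y ∈ v
    · have hya : y ≠ a := fun h => hav (h ▸ hy)
      have := hc y
      rw [List.count_eq_zero_of_not_mem (hvw y hy)] at this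
      simpa [hya, hvS y hy, hy] using this
    · simp [hy, List.count_eq_zero_of_not_mem hy]
  · ext y
    rw [Multiset.count_add, count_nsmul_val, Multiset.coe_count, Multiset.count_replicate]
    have := hc y
    by_cases hy : y ∈ v
    · have hya : y ≠ a := fun h => hav (h ▸ hy)
      simp [hy, Ne.symm hya, List.count_eq_zero_of_not_mem (hvw y hy)]
    · rw [List.count_eq_zero_of_not_mem hy] at this
      by_cases hya : y = a
      · subst hya
        simp [ha] at this
        simp [ha, this]
      · simp [hya] at this
        simp [hy, Ne.symm hya, this]

/-! ### Weights and the recursions for weighted sums -/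

noncomputable section

/-- The weight of two consecutive letters `x`, `y`. -/
def step (x y : ℕ) : Poly := if x < y then q else if y < x then t else u

/-- The weight of the word `w` between the letters `c` and `b`. -/
def weight : ℕ → List ℕ → ℕ → Poly
  | c, [], b => step c b
  | c, a :: w, b => step c a * weight a w b

lemma weight_append (c : ℕ) (v : List ℕ) (a : ℕ) (w : List ℕ) (b : ℕ) :
    weight c (v ++ a :: w) b = weight c v a * weight a w b := by
  induction v generalizing c with
  | nil => rfl
  | cons x v ih => simp [weight, ih, mul_assoc]

/-- The total weight of the noncrossing words on `S` placed between `c` and `b`. -/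
def wordSum (k c b : ℕ) (S : Finset ℕ) : Poly := ∑ w ∈ words k S, weight c w b

/-- The total weight of the words in `tails k a j S` placed between `a` and `b`. -/
def tailSum (k a j b : ℕ) (S : Finset ℕ) : Poly := ∑ v ∈ tails k a j S, weight a v b

lemma wordSum_empty (k c b : ℕ) : wordSum k c b ∅ = step c b := by
  simp [wordSum, words_empty, weight]

lemma wordSum_eq {r c b : ℕ} {S : Finset ℕ} (hS : S.Nonempty) :
    wordSum (r + 1) c b S =
      ∑ a ∈ S, step c a * tailSum (r + 1) a r b (S.erase a) := by
  simp only [wordSum, tailSum, Finset.mul_sum]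
  rw [Finset.sum_sigma']
  symm
  refine Finset.sum_bij (fun p _ => p.1 :: p.2) ?_ ?_ ?_ ?_
  · rintro ⟨a, v⟩ h
    simpa [cons_mem_words] using h
  · rintro ⟨a, v⟩ _ ⟨a', v'⟩ _ h
    simp only [List.cons.injEq] at h
    obtain ⟨rfl, rfl⟩ := h
    rfl
  · rintro (_ | ⟨a, v⟩) h
    · obtain ⟨x, hx⟩ := hS
      have := congrArg (Multiset.count x) (mem_words.1 h).1
      rw [count_nsmul_val] at this
      simp [hx] at this
    · exact ⟨⟨a, v⟩, by simpa [cons_mem_words] using h, rfl⟩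
  · intros; rfl

lemma tailSum_zero {k a b : ℕ} {S : Finset ℕ} (ha : a ∉ S) :
    tailSum k a 0 b S = wordSum k a b S := by
  rw [tailSum, tails_zero ha, wordSum]

/-- Weights multiply at a cut, and the block before the next `a` stands between two copies of `a`.
-/
lemma tailSum_succ {k a j b : ℕ} {S : Finset ℕ} (ha : a ∉ S) (hk : k ≠ 0) :
    tailSum k a (j + 1) b S =
      ∑ T ∈ S.powerset, wordSum k a a T * tailSum k a j b (S \ T) := by
  simp only [wordSum, tailSum, Finset.sum_mul_sum, ← Finset.sum_product']
  rw [Finset.sum_sigma']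
  symm
  refine Finset.sum_bij (fun p _ => p.2.1 ++ a :: p.2.2) ?_ ?_ ?_ ?_
  · rintro ⟨T, v, w⟩ h
    simp only [Finset.mem_sigma, Finset.mem_powerset, Finset.mem_product] at h
    exact append_mem_tails ha h.1 h.2.1 h.2.2
  · rintro ⟨T, v, w⟩ h ⟨T', v', w'⟩ h' he
    simp only [Finset.mem_sigma, Finset.mem_powerset, Finset.mem_product] at h h'
    have hv : a ∉ v := fun hm => ha (h.1 (mem_of_mem_words h.2.1 hm))
    have hv' : a ∉ v' := fun hm => ha (h'.1 (mem_of_mem_words h'.2.1 hm))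
    obtain ⟨rfl, rfl⟩ := append_cons_inj_of_first_occurrence hv hv' he
    -- `T` is recovered as the set of letters of the block; this is where `k ≠ 0` is needed.
    have hT : T = T' := by
      ext x
      have := congrArg (Multiset.count x)
        ((mem_words.1 h.2.1).1.symm.trans (mem_words.1 h'.2.1).1)
      rw [count_nsmul_val, count_nsmul_val] at this
      by_cases h1 : x ∈ T <;> by_cases h2 : x ∈ T' <;> simp [h1, h2, hk, hk.symm] at this ⊢
    subst hT
    rfl
  · intro x hx
    obtain ⟨T, hT, v, hv, w, hw, rfl⟩ := exists_of_mem_tails ha hx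
    exact ⟨⟨T, v, w⟩, by simp [hT, hv, hw], rfl⟩
  · rintro ⟨T, v, w⟩ _
    exact (weight_append _ _ _ _ _).symm

end

end QuasiStirling

open PowerSeries

namespace QuasiStirling

/-! ### Reindexing sums over pairs of disjoint subsets -/

section PowersetSums

variable {α M : Type*} [DecidableEq α] [AddCommMonoid M]

lemma sum_powerset_sum_sdiff (S : Finset α) (φ : Finset α → Finset α → M) :
    ∑ A ∈ S.powerset, ∑ B ∈ (S \ A).powerset, φ A B =
      ∑ U ∈ S.powerset, ∑ A ∈ U.powerset, φ A (U \ A) := by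
  rw [Finset.sum_sigma', Finset.sum_sigma']
  refine Finset.sum_bij' (fun p _ => ⟨p.1 ∪ p.2, p.1⟩) (fun p _ => ⟨p.2, p.1 \ p.2⟩) ?_ ?_ ?_ ?_ ?_
  · rintro ⟨A, B⟩ h
    simp only [Finset.mem_sigma, Finset.mem_powerset, Finset.subset_sdiff] at h ⊢
    exact ⟨Finset.union_subset h.1 h.2.1, Finset.subset_union_left⟩
  · rintro ⟨U, A⟩ h
    simp only [Finset.mem_sigma, Finset.mem_powerset] at h ⊢
    exact ⟨h.2.trans h.1, Finset.sdiff_subset_sdiff h.1 le_rfl⟩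
  · rintro ⟨A, B⟩ h
    simp only [Finset.mem_sigma, Finset.mem_powerset, Finset.subset_sdiff] at h
    simp [Finset.union_sdiff_cancel_left h.2.2.symm]
  · rintro ⟨U, A⟩ h
    simp only [Finset.mem_sigma, Finset.mem_powerset] at h
    simp [Finset.union_eq_right.2 h.2]
  · rintro ⟨A, B⟩ h
    simp only [Finset.mem_sigma, Finset.mem_powerset, Finset.subset_sdiff] at h
    simp [Finset.union_sdiff_cancel_left h.2.2.symm]

lemma sum_powerset_sdiff_comm (S : Finset α) (φ : Finset α → Finset α → M) :
    ∑ A ∈ S.powerset, ∑ B ∈ (S \ A).powerset, φ A B =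
      ∑ B ∈ S.powerset, ∑ A ∈ (S \ B).powerset, φ A B := by
  refine Finset.sum_comm' fun A B => ?_
  simp only [Finset.mem_powerset, Finset.subset_sdiff]
  exact ⟨fun h => ⟨⟨h.1, h.2.2.symm⟩, h.2.1⟩, fun h => ⟨h.1.1, h.2, h.1.2.symm⟩⟩

/-- Both sides run over subsets with a marked element; the mark will be the first letter of a word.
-/
lemma sum_sum_powerset_erase (S : Finset α) (φ : α → Finset α → M) :
    ∑ a ∈ S, ∑ T ∈ (S.erase a).powerset, φ a (insert a T) =
      ∑ T ∈ S.powerset, ∑ a ∈ T, φ a T := by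
  rw [Finset.sum_sigma', Finset.sum_sigma']
  refine Finset.sum_bij' (fun p _ => ⟨insert p.1 p.2, p.1⟩) (fun p _ => ⟨p.2, p.1.erase p.2⟩)
    ?_ ?_ ?_ ?_ ?_
  · rintro ⟨a, T⟩ h
    simp only [Finset.mem_sigma, Finset.mem_powerset] at h ⊢
    exact ⟨Finset.insert_subset h.1 (h.2.trans (Finset.erase_subset _ _)),
      Finset.mem_insert_self _ _⟩
  · rintro ⟨T, a⟩ h
    simp only [Finset.mem_sigma, Finset.mem_powerset] at h ⊢
    exact ⟨h.1 h.2, Finset.erase_subset_erase _ h.1⟩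
  · rintro ⟨a, T⟩ h
    simp only [Finset.mem_sigma, Finset.mem_powerset] at h
    simp [Finset.erase_insert fun h' => Finset.notMem_erase a S (h.2 h')]
  · rintro ⟨T, a⟩ h
    simp only [Finset.mem_sigma, Finset.mem_powerset] at h
    simp [Finset.insert_erase h.2]
  · intros; rfl

lemma sum_powerset_sdiff_swap (S : Finset α) (φ : Finset α → Finset α → M) :
    ∑ A ∈ S.powerset, φ A (S \ A) = ∑ A ∈ S.powerset, φ (S \ A) A := by
  refine Finset.sum_bij' (fun A _ => S \ A) (fun A _ => S \ A) ?_ ?_ ?_ ?_ ?_ <;>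
    intro A h <;> simp only [Finset.mem_powerset] at h
  · simp
  · simp
  · simp [Finset.inter_eq_right.2 h]
  · simp [Finset.inter_eq_right.2 h]
  · simp [Finset.inter_eq_right.2 h]

end PowersetSums

/-! ### Exponential generating functions as sums over subsets -/

noncomputable section

/-- The coefficient of `z ^ n / n!` in a power series. -/
def egfCoeff (F : PowerSeries Poly) (n : ℕ) : Poly := (n.factorial : ℚ) • coeff n F

lemma egfCoeff_egf (a : ℕ → Poly) (n : ℕ) : egfCoeff (egf a) n = a n := by
  rw [egfCoeff, egf, coeff_mk, smul_smul, mul_one_div_cancel (by positivity), one_smul]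

lemma egfCoeff_one (n : ℕ) : egfCoeff 1 n = if n = 0 then 1 else 0 := by
  rw [egfCoeff, coeff_one]
  split_ifs with h
  · simp [h]
  · simp

lemma egfCoeff_mul (F G : PowerSeries Poly) (S : Finset ℕ) :
    ∑ T ∈ S.powerset, egfCoeff F T.card * egfCoeff G (S \ T).card =
      egfCoeff (F * G) S.card := by
  have h1 : ∑ T ∈ S.powerset, egfCoeff F T.card * egfCoeff G (S \ T).card =
      ∑ T ∈ S.powerset, egfCoeff F T.card * egfCoeff G (S.card - T.card) := by
    refine Finset.sum_congr rfl fun T hT => ?_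
    rw [Finset.card_sdiff_of_subset (Finset.mem_powerset.1 hT)]
  rw [h1, Finset.sum_powerset_apply_card (fun m => egfCoeff F m * egfCoeff G (S.card - m)),
    egfCoeff, coeff_mul, Finset.Nat.sum_antidiagonal_eq_sum_range_succ_mk, Finset.smul_sum]
  refine Finset.sum_congr rfl fun m hm => ?_
  have hm : m ≤ S.card := Nat.lt_succ_iff.1 (Finset.mem_range.1 hm)
  rw [egfCoeff, egfCoeff, smul_mul_smul_comm, ← Nat.cast_smul_eq_nsmul ℚ, smul_smul,
    ← Nat.choose_mul_factorial_mul_factorial hm]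
  push_cast
  rw [mul_assoc]

/-! ### Eulerian sums -/

lemma wordSum_one_eq {c b : ℕ} {S : Finset ℕ} (hS : S.Nonempty) :
    wordSum 1 c b S = ∑ a ∈ S, step c a * wordSum 1 a b (S.erase a) := by
  rw [wordSum_eq (r := 0) hS]
  refine Finset.sum_congr rfl fun a _ => ?_
  rw [tailSum_zero (Finset.notMem_erase _ _)]

/-- Cutting a permutation at the letter `x`: `T` is the set of letters before `x`. The induction
peels off the first letter. -/
lemma wordSum_one_split {x : ℕ} (c b : ℕ) (V : Finset ℕ) (hx : x ∉ V) :
    wordSum 1 c b (insert x V) =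
      ∑ T ∈ V.powerset, wordSum 1 c x T * wordSum 1 x b (V \ T) := by
  induction hn : V.card using Nat.strong_induction_on generalizing c V with
  | _ n ih =>
  subst hn
  rw [wordSum_one_eq (Finset.insert_nonempty _ _), Finset.sum_insert hx, Finset.erase_insert hx]
  have h1 : ∀ a ∈ V, step c a * wordSum 1 a b ((insert x V).erase a) =
      ∑ T ∈ (V.erase a).powerset, step c a * wordSum 1 a x ((insert a T).erase a) *
        wordSum 1 x b (V \ insert a T) := by
    intro a ha
    have hax : a ≠ x := fun h => hx (h ▸ ha)
    rw [Finset.erase_insert_of_ne hax.symm,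
      ih _ (Finset.card_erase_lt_of_mem ha) a (V.erase a)
        (fun h => hx (Finset.mem_of_mem_erase h)) rfl, Finset.mul_sum]
    refine Finset.sum_congr rfl fun T hT => ?_
    have haT : a ∉ T := fun h => Finset.notMem_erase a V (Finset.mem_powerset.1 hT h)
    rw [Finset.erase_insert haT, mul_assoc, Finset.erase_sdiff_comm, Finset.sdiff_insert]
  rw [Finset.sum_congr rfl h1, sum_sum_powerset_erase V
    (fun a T => step c a * wordSum 1 a x (T.erase a) * wordSum 1 x b (V \ T))]
  -- The term `T = ∅` accounts for the words that begin with `x`.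
  have h0 : ∅ ∈ V.powerset := by simp
  rw [← Finset.add_sum_erase _ _ h0, ← Finset.add_sum_erase _ _ h0]
  simp only [Finset.sum_empty, zero_add, wordSum_empty, Finset.sdiff_empty]
  congr 1
  refine Finset.sum_congr rfl fun T hT => ?_
  rw [wordSum_one_eq (c := c) (Finset.nonempty_iff_ne_empty.2 (Finset.ne_of_mem_erase hT)),
    Finset.sum_mul]

/-- Both sides weigh the cyclic arrangements of `U`, read from `c` or from `d`. Cutting each at the
other letter gives the same two arcs in opposite order. -/
lemma wordSum_one_rotate {c d : ℕ} {U : Finset ℕ} (hc : c ∈ U) (hd : d ∈ U) :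
    wordSum 1 c c (U.erase c) = wordSum 1 d d (U.erase d) := by
  rcases eq_or_ne c d with rfl | hcd
  · rfl
  rw [← Finset.insert_erase (Finset.mem_erase.2 ⟨hcd.symm, hd⟩),
    ← Finset.insert_erase (Finset.mem_erase.2 ⟨hcd, hc⟩),
    wordSum_one_split c c _ (Finset.notMem_erase _ _),
    wordSum_one_split d d _ (Finset.notMem_erase _ _), Finset.erase_right_comm,
    sum_powerset_sdiff_swap _ fun A B => wordSum 1 c d A * wordSum 1 d c B]
  exact Finset.sum_congr rfl fun T _ => mul_comm _ _

/-- Only the last step sees the right end, and its weight does not depend on the last letter. The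
cross-multiplied form avoids division. -/
lemma wordSum_one_last {b b' : ℕ} {β β' : Poly} {S : Finset ℕ} (hS : S.Nonempty)
    (h : ∀ y ∈ S, step y b = β) (h' : ∀ y ∈ S, step y b' = β') (c : ℕ) :
    β' * wordSum 1 c b S = β * wordSum 1 c b' S := by
  induction hn : S.card using Nat.strong_induction_on generalizing c S with
  | _ n ih =>
  subst hn
  rw [wordSum_one_eq hS, wordSum_one_eq hS, Finset.mul_sum, Finset.mul_sum]
  refine Finset.sum_congr rfl fun a ha => ?_
  rw [mul_left_comm, mul_left_comm β]
  congr 1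
  rcases (S.erase a).eq_empty_or_nonempty with he | he
  · rw [he, wordSum_empty, wordSum_empty, h a ha, h' a ha, mul_comm]
  · exact ih _ (Finset.card_erase_lt_of_mem ha) he
      (fun y hy => h y (Finset.mem_of_mem_erase hy))
      (fun y hy => h' y (Finset.mem_of_mem_erase hy)) a rfl

lemma wordSum_one_first {c c' : ℕ} {γ γ' : Poly} {S : Finset ℕ} (hS : S.Nonempty)
    (h : ∀ y ∈ S, step c y = γ) (h' : ∀ y ∈ S, step c' y = γ') (b : ℕ) :
    γ' * wordSum 1 c b S = γ * wordSum 1 c' b S := by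
  rw [wordSum_one_eq hS, wordSum_one_eq hS, Finset.mul_sum, Finset.mul_sum]
  refine Finset.sum_congr rfl fun a ha => ?_
  rw [h a ha, h' a ha, mul_left_comm]

lemma step_self (x : ℕ) : step x x = u := by simp [step]

lemma step_of_lt {x y : ℕ} (h : x < y) : step x y = q := by simp [step, h]

lemma step_of_gt {x y : ℕ} (h : y < x) : step x y = t := by simp [step, h, h.le]

lemma q_mul_t_ne_zero : q * t ≠ 0 := mul_ne_zero (MvPolynomial.X_ne_zero _) (MvPolynomial.X_ne_zero _)

/-- The total weight of the permutations of `{1, …, n}` placed between two zeros. -/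
def eulerianSum (n : ℕ) : Poly := wordSum 1 0 0 (Finset.Icc 1 n)

lemma eulerianSum_zero : eulerianSum 0 = u := by
  simp [eulerianSum, wordSum_empty, step_self]

/-- Splitting a cyclic arrangement at its smallest and its largest element. -/
lemma wordSum_one_min_max {m x : ℕ} {V : Finset ℕ} (hmx : m < x) (hm : ∀ y ∈ V, m < y)
    (hx : ∀ y ∈ V, y < x) :
    wordSum 1 m m (insert x V) =
      ∑ T ∈ V.powerset, (if T = ∅ then t else wordSum 1 m m T) *
        (if V \ T = ∅ then q else wordSum 1 m m (V \ T)) := by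
  rw [wordSum_one_split m m V fun h => (hx x h).false]
  refine mul_left_cancel₀ q_mul_t_ne_zero ?_
  rw [Finset.mul_sum, Finset.mul_sum]
  refine Finset.sum_congr rfl fun T hT => ?_
  have hT := Finset.mem_powerset.1 hT
  -- Moving the right end from the maximum `x` to the minimum `m` turns the last ascent into a
  -- descent. For `T = ∅` the default `t` keeps the relation true, since the step from `m` to `x`
  -- weighs `q`.
  have h1 : t * wordSum 1 m x T = q * if T = ∅ then t else wordSum 1 m m T := by
    split_ifs with h
    · rw [h, wordSum_empty, step_of_lt hmx, mul_comm]
    · exact wordSum_one_last (Finset.nonempty_iff_ne_empty.2 h)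
        (fun y hy => step_of_lt (hx y (hT hy))) (fun y hy => step_of_gt (hm y (hT hy))) m
  have h2 : q * wordSum 1 x m (V \ T) =
      t * if V \ T = ∅ then q else wordSum 1 m m (V \ T) := by
    split_ifs with h
    · rw [h, wordSum_empty, step_of_gt hmx, mul_comm]
    · exact wordSum_one_first (Finset.nonempty_iff_ne_empty.2 h)
        (fun y hy => step_of_gt (hx y (Finset.mem_sdiff.1 hy).1))
        (fun y hy => step_of_lt (hm y (Finset.mem_sdiff.1 hy).1)) m
  linear_combination (wordSum 1 x m (V \ T) * q) * h1 + q * (if T = ∅ then t else wordSum 1 m m T) * h2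

/-- Rotation makes the minimum the base point, and cutting at the maximum leaves two smaller arcs
based at the minimum. By induction these depend only on their sizes. -/
lemma wordSum_one_cyclic {c : ℕ} {S : Finset ℕ} (hc : c ∉ S) :
    wordSum 1 c c S = eulerianSum S.card := by
  have key : ∀ n : ℕ, ∀ c d : ℕ, ∀ S T : Finset ℕ, c ∉ S → d ∉ T → S.card = n → T.card = n →
      wordSum 1 c c S = wordSum 1 d d T := by
    intro n
    induction n using Nat.strong_induction_on with
    | _ n ih =>
    rcases Nat.eq_zero_or_pos n with rfl | hn
    · intro c d S T _ _ hS hT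
      rw [Finset.card_eq_zero.1 hS, Finset.card_eq_zero.1 hT]
      simp [wordSum_empty, step_self]
    have red : ∀ c : ℕ, ∀ S : Finset ℕ, c ∉ S → S.card = n → ∃ V : Finset ℕ, ∃ m x : ℕ,
        V.card + 1 = n ∧ m < x ∧ (∀ y ∈ V, m < y) ∧ (∀ y ∈ V, y < x) ∧
          wordSum 1 c c S = wordSum 1 m m (insert x V) := by
      intro c S hc hS
      have hne : (insert c S).Nonempty := Finset.insert_nonempty _ _
      set U := insert c S with hU
      have hUc : U.card = n + 1 := by rw [hU, Finset.card_insert_of_notMem hc, hS]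
      set m := U.min' hne with hm
      have hmU : m ∈ U := Finset.min'_mem _ _
      have hVne : (U.erase m).Nonempty := by
        rw [← Finset.card_pos, Finset.card_erase_of_mem hmU]; omega
      set x := (U.erase m).max' hVne with hx
      have hxU : x ∈ U.erase m := Finset.max'_mem _ _
      have hlt : ∀ y ∈ U.erase m, m < y := fun y hy =>
        lt_of_le_of_ne (Finset.min'_le _ _ (Finset.mem_of_mem_erase hy))
          (Finset.ne_of_mem_erase hy).symm
      refine ⟨(U.erase m).erase x, m, x, ?_, hlt x hxU,
        fun y hy => hlt y (Finset.mem_of_mem_erase hy), fun y hy =>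
        lt_of_le_of_ne (Finset.le_max' _ _ (Finset.mem_of_mem_erase hy))
          (Finset.ne_of_mem_erase hy), ?_⟩
      · rw [Finset.card_erase_of_mem hxU, Finset.card_erase_of_mem hmU]; omega
      · rw [Finset.insert_erase hxU, ← wordSum_one_rotate (Finset.mem_insert_self c S) hmU,
          Finset.erase_insert hc]
    have val : ∀ V : Finset ℕ, ∀ m x : ℕ, V.card + 1 = n → m < x → (∀ y ∈ V, m < y) →
        (∀ y ∈ V, y < x) → wordSum 1 m m (insert x V) =
          ∑ j ∈ Finset.range n, (n - 1).choose j •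
            ((if j = 0 then t else eulerianSum j) *
              if n - 1 - j = 0 then q else eulerianSum (n - 1 - j)) := by
      intro V m x hV hmx hm hx
      rw [wordSum_one_min_max hmx hm hx]
      have hV' : V.card = n - 1 := by omega
      have := Finset.sum_powerset_apply_card (fun j => (if j = 0 then t else eulerianSum j) *
              if n - 1 - j = 0 then q else eulerianSum (n - 1 - j)) (x := V)
      rw [hV', Nat.sub_add_cancel hn] at this
      rw [← this]
      -- Two letters, `m` and `x`, have been taken out of the `n + 1` on the circle, so the
      -- induction hypothesis applies to every arc.
      have e : ∀ T ⊆ V, wordSum 1 m m T = eulerianSum T.card := by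
        intro T hT
        have := Finset.card_le_card hT
        exact ih T.card (by omega) m 0 T _ (fun h => (hm m (hT h)).false) (by simp) rfl (by simp)
      refine Finset.sum_congr rfl fun T hT => ?_
      have hT := Finset.mem_powerset.1 hT
      rw [e T hT, e _ Finset.sdiff_subset, ← hV', ← Finset.card_sdiff_of_subset hT]
      simp only [Finset.card_eq_zero]
    intro c d S T hc hd hS hT
    obtain ⟨V, m, x, h1, h2, h3, h4, h5⟩ := red c S hc hS
    obtain ⟨V', m', x', h1', h2', h3', h4', h5'⟩ := red d T hd hT
    rw [h5, h5', val V m x h1 h2 h3 h4, val V' m' x' h1' h2' h3' h4']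
  exact key _ c 0 S _ hc (by simp) rfl (by simp)

/-- The cut at the maximum `n + 1` with base point `0`, in the form that becomes the differential
equation for `Ahat`. -/
lemma eulerianSum_succ (n : ℕ) :
    eulerianSum (n + 1) =
      egfCoeff (egf (fun j => if j = 0 then t else eulerianSum j) *
        egf (fun j => if j = 0 then q else eulerianSum j)) n := by
  have hI : Finset.Icc 1 (n + 1) = insert (n + 1) (Finset.Icc 1 n) := by
    ext x; simp only [Finset.mem_Icc, Finset.mem_insert]; omega
  have hn : (Finset.Icc 1 n).card = n := by simp
  rw [eulerianSum, hI, wordSum_one_min_max (by omega) (fun y hy => by simp at hy; omega)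
    (fun y hy => by simp at hy; omega)]
  conv_rhs => rw [← hn]
  rw [← egfCoeff_mul]
  refine Finset.sum_congr rfl fun T hT => ?_
  have hT := Finset.mem_powerset.1 hT
  have h0 : ∀ R ⊆ Finset.Icc 1 n, 0 ∉ R := fun R hR h => by simpa using hR h
  rw [egfCoeff_egf, egfCoeff_egf, wordSum_one_cyclic (h0 T hT),
    wordSum_one_cyclic (h0 _ Finset.sdiff_subset)]
  simp only [Finset.card_eq_zero]

/-! ### Composition -/

/-- The total weight of the noncrossing words on `{1, …, n}` placed between two zeros. -/
def stirlingSum (k n : ℕ) : Poly := wordSum k 0 0 (Finset.Icc 1 n)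

/-- The `j` blocks closed by the remaining copies of `a` use disjoint sets of letters with union
`T`. By `hF` each has generating function `F`, hence together `F ^ j`. -/
lemma tailSum_eq_sum {k a b : ℕ} (F : PowerSeries Poly) {S : Finset ℕ} (hk : k ≠ 0) (ha : a ∉ S)
    (hF : ∀ T ⊆ S, wordSum k a a T = egfCoeff F T.card) (j : ℕ) :
    tailSum k a j b S =
      ∑ T ∈ S.powerset, egfCoeff (F ^ j) T.card * wordSum k a b (S \ T) := by
  induction j generalizing S with
  | zero =>
    rw [tailSum_zero ha, ← Finset.add_sum_erase _ _ (Finset.empty_mem_powerset S)]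
    rw [Finset.sum_eq_zero]
    · simp [egfCoeff_one]
    · intro T hT
      have := Finset.ne_of_mem_erase hT
      simp [egfCoeff_one, this]
  | succ j ih =>
    rw [tailSum_succ ha hk]
    have h1 : ∀ A ∈ S.powerset, wordSum k a a A * tailSum k a j b (S \ A) =
        ∑ B ∈ (S \ A).powerset, egfCoeff F A.card * egfCoeff (F ^ j) B.card *
          wordSum k a b (S \ (A ∪ B)) := by
      intro A hA
      have hA := Finset.mem_powerset.1 hA
      rw [ih (fun h => ha (Finset.sdiff_subset h)) fun T hT => hF T (hT.trans Finset.sdiff_subset),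
        hF A hA, Finset.mul_sum]
      refine Finset.sum_congr rfl fun B _ => ?_
      rw [mul_assoc, sdiff_sdiff_left]
      rfl
    rw [Finset.sum_congr rfl h1, sum_powerset_sum_sdiff S fun A B =>
      egfCoeff F A.card * egfCoeff (F ^ j) B.card * wordSum k a b (S \ (A ∪ B))]
    refine Finset.sum_congr rfl fun U _ => ?_
    rw [pow_succ', ← egfCoeff_mul, Finset.sum_mul]
    refine Finset.sum_congr rfl fun A hA => ?_
    rw [Finset.union_sdiff_of_subset (Finset.mem_powerset.1 hA)]

/-- `T` is the set of outer letters. With the blocks contracted they form a permutation of `T`, and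
each carries `r` blocks with generating function `F ^ r`. The induction removes the first outer
letter together with its blocks. -/
lemma wordSum_eq_sum {r : ℕ} (F : PowerSeries Poly) {S : Finset ℕ}
    (hF : ∀ a ∈ S, ∀ T ⊆ S.erase a, wordSum (r + 1) a a T = egfCoeff F T.card) (c b : ℕ) :
    wordSum (r + 1) c b S =
      ∑ T ∈ S.powerset, wordSum 1 c b T * egfCoeff ((F ^ r) ^ T.card) (S \ T).card := by
  induction hn : S.card using Nat.strong_induction_on generalizing c S with
  | _ n ih =>
  subst hn
  rcases S.eq_empty_or_nonempty with rfl | hS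
  · simp [wordSum_empty, egfCoeff_one]
  have h1 : ∀ a ∈ S, step c a * tailSum (r + 1) a r b (S.erase a) =
      ∑ T ∈ (S.erase a).powerset, step c a * wordSum 1 a b ((insert a T).erase a) *
        egfCoeff ((F ^ r) ^ (insert a T).card) (S \ insert a T).card := by
    intro a ha
    rw [tailSum_eq_sum F r.succ_ne_zero (Finset.notMem_erase _ _) (hF a ha)]
    have h2 : ∀ A ∈ (S.erase a).powerset,
        egfCoeff (F ^ r) A.card * wordSum (r + 1) a b (S.erase a \ A) =
          ∑ B ∈ (S.erase a \ A).powerset, egfCoeff (F ^ r) A.card *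
            (wordSum 1 a b B * egfCoeff ((F ^ r) ^ B.card) ((S.erase a \ B) \ A).card) := by
      intro A _
      have hs : S.erase a \ A ⊆ S := Finset.sdiff_subset.trans (Finset.erase_subset _ _)
      rw [ih (S.erase a \ A).card ?_ (fun d hd T hT => hF d (hs hd) T
        (hT.trans (Finset.erase_subset_erase _ hs))) a rfl, Finset.mul_sum]
      · refine Finset.sum_congr rfl fun B _ => ?_
        rw [sdiff_right_comm]
      · exact (Finset.card_le_card Finset.sdiff_subset).trans_lt (Finset.card_erase_lt_of_mem ha)
    rw [Finset.sum_congr rfl h2, sum_powerset_sdiff_comm (S.erase a) fun A B =>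
      egfCoeff (F ^ r) A.card *
        (wordSum 1 a b B * egfCoeff ((F ^ r) ^ B.card) ((S.erase a \ B) \ A).card),
      Finset.mul_sum]
    refine Finset.sum_congr rfl fun T hT => ?_
    have haT : a ∉ T := fun h => Finset.notMem_erase a S (Finset.mem_powerset.1 hT h)
    rw [Finset.erase_insert haT, Finset.card_insert_of_notMem haT, Finset.sdiff_insert,
      ← Finset.erase_sdiff_comm, pow_succ', ← egfCoeff_mul, Finset.mul_sum, Finset.mul_sum]
    refine Finset.sum_congr rfl fun A _ => ?_
    ring
  rw [wordSum_eq hS, Finset.sum_congr rfl h1, sum_sum_powerset_erase S fun a T =>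
    step c a * wordSum 1 a b (T.erase a) * egfCoeff ((F ^ r) ^ T.card) (S \ T).card]
  refine Finset.sum_congr rfl fun T _ => ?_
  rcases T.eq_empty_or_nonempty with rfl | hT
  · simp [egfCoeff_one, hS.ne_empty]
  · rw [wordSum_one_eq hT, Finset.sum_mul]

lemma wordSum_cyclic {r c : ℕ} {S : Finset ℕ} (hc : c ∉ S) :
    wordSum (r + 1) c c S = stirlingSum (r + 1) S.card := by
  have key : ∀ n : ℕ, ∀ c d : ℕ, ∀ S T : Finset ℕ, c ∉ S → d ∉ T → S.card = n → T.card = n →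
      wordSum (r + 1) c c S = wordSum (r + 1) d d T := by
    intro n
    induction n using Nat.strong_induction_on with
    | _ n ih =>
    have val : ∀ c : ℕ, ∀ S : Finset ℕ, c ∉ S → S.card = n → wordSum (r + 1) c c S =
        ∑ j ∈ Finset.range (n + 1), n.choose j • (eulerianSum j *
          egfCoeff ((egf (stirlingSum (r + 1)) ^ r) ^ j) (n - j)) := by
      intro c S hc hS
      rw [wordSum_eq_sum (egf (stirlingSum (r + 1)))]
      · subst hS
        rw [← Finset.sum_powerset_apply_card (fun j => eulerianSum j *
          egfCoeff ((egf (stirlingSum (r + 1)) ^ r) ^ j) (S.card - j))]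
        refine Finset.sum_congr rfl fun T hT => ?_
        have hT := Finset.mem_powerset.1 hT
        rw [wordSum_one_cyclic fun h => hc (hT h), Finset.card_sdiff_of_subset hT]
      · intro a ha T hT
        rw [egfCoeff_egf]
        have := (Finset.card_le_card hT).trans_lt (Finset.card_erase_lt_of_mem ha)
        exact ih T.card (by omega) a 0 T _ (fun h => Finset.notMem_erase a S (hT h)) (by simp) rfl
          (by simp)
    intro c d S T hc hd hS hT
    rw [val c S hc hS, val d T hd hT]
  exact key _ c 0 S _ hc (by simp) rfl (by simp)

lemma stirlingSum_eq (r n : ℕ) : stirlingSum (r + 1) n =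
    ∑ j ∈ Finset.range (n + 1), n.choose j • (eulerianSum j *
      egfCoeff ((egf (stirlingSum (r + 1)) ^ r) ^ j) (n - j)) := by
  have hn : (Finset.Icc 1 n).card = n := by simp
  rw [stirlingSum, wordSum_eq_sum (egf (stirlingSum (r + 1)))]
  · conv_rhs => rw [← hn]
    rw [← Finset.sum_powerset_apply_card (fun j => eulerianSum j *
          egfCoeff ((egf (stirlingSum (r + 1)) ^ r) ^ j) ((Finset.Icc 1 n).card - j))]
    refine Finset.sum_congr rfl fun T hT => ?_
    have hT := Finset.mem_powerset.1 hT
    rw [wordSum_one_cyclic fun h => by simpa using hT h, Finset.card_sdiff_of_subset hT]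
  · intro a _ T hT
    rw [egfCoeff_egf, wordSum_cyclic fun h => Finset.notMem_erase a _ (hT h)]

end

end QuasiStirling

namespace QuasiStirling

/-! ### Weights and statistics -/

lemma weight_eq_prod (c : ℕ) (w : List ℕ) :
    weight c w 0 =
      ∏ i ∈ Finset.range (w.length + 1), step ((c :: w).getD i 0) (w.getD i 0) := by
  induction w generalizing c with
  | nil => simp [weight]
  | cons a w ih =>
    rw [List.length_cons, Finset.prod_range_succ', weight, ih, mul_comm]
    simp

lemma prod_step {ι : Type*} [DecidableEq ι] (s : Finset ι) (x y : ι → ℕ) :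
    ∏ i ∈ s, step (x i) (y i) =
      q ^ (s.filter fun i => x i < y i).card * t ^ (s.filter fun i => x i > y i).card *
        u ^ (s.filter fun i => x i = y i).card := by
  induction s using Finset.induction_on with
  | empty => simp
  | insert i s hi ih =>
    rw [Finset.prod_insert hi, ih, Finset.filter_insert, Finset.filter_insert,
      Finset.filter_insert]
    rcases lt_trichotomy (x i) (y i) with h | h | h
    · rw [if_pos h, if_neg h.not_gt, if_neg h.ne, Finset.card_insert_of_notMem (by simp [hi]),
        step_of_lt h]
      ring
    · rw [if_neg h.not_lt, if_neg h.not_gt, if_pos h, Finset.card_insert_of_notMem (by simp [hi]),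
        h, step_self]
      ring
    · rw [if_neg h.not_gt, if_pos h, if_neg h.ne', Finset.card_insert_of_notMem (by simp [hi]),
        step_of_gt h]
      ring

lemma entry_pos {w : List ℕ} (hpos : ∀ x ∈ w, 0 < x) {i : ℕ} (hi : i < w.length) :
    0 < w.getD i 0 := by
  rw [List.getD_eq_getElem _ _ hi]
  exact hpos _ (List.getElem_mem hi)

lemma weight_eq_statistics {w : List ℕ} (hw : w ≠ []) (hpos : ∀ x ∈ w, 0 < x) :
    weight 0 w 0 = q ^ asc w * t ^ des w * u ^ plat w := by
  have hlen : 0 < w.length := List.length_pos_iff.2 hw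
  have h0 := entry_pos hpos hlen
  have hl : w.getD w.length 0 = 0 := by simp
  have hlast : 0 < w.getD (w.length - 1) 0 := entry_pos hpos (by omega)
  have hasc : ((Finset.range (w.length + 1)).filter
      fun i => (0 :: w).getD i 0 < w.getD i 0).card = asc w := by
    rw [asc]
    congr 1
    ext i
    rw [Finset.mem_filter, Finset.mem_filter, Finset.mem_range, Finset.mem_range, entry, entry]
    rcases i with _ | i
    · simp only [List.getD_cons_zero, true_or, and_true]
      exact ⟨fun _ => hlen, fun _ => ⟨by omega, h0⟩⟩
    · simp only [List.getD_cons_succ, Nat.add_sub_cancel, Nat.succ_ne_zero, false_or]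
      refine ⟨fun h => ⟨?_, h.2⟩, fun h => ⟨by omega, h.2⟩⟩
      rcases (Nat.lt_succ_iff.1 h.1).lt_or_eq with h' | h'
      · exact h'
      · rw [h', hl] at h; omega
  have hdes : ((Finset.range (w.length + 1)).filter
      fun i => (0 :: w).getD i 0 > w.getD i 0).card = des w := by
    rw [des]
    congr 1
    ext i
    rw [Finset.mem_filter, Finset.mem_filter, Finset.mem_range, Finset.mem_Icc, entry, entry]
    rcases i with _ | i
    · simp
    · simp only [List.getD_cons_succ, Nat.add_sub_cancel]
      refine ⟨fun h => ⟨by omega, Or.inr h.2⟩, fun h => ⟨by omega, ?_⟩⟩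
      rcases h.2 with h' | h'
      · rw [h', hl, show i = w.length - 1 by omega]; exact hlast
      · exact h'
  have hplat : ((Finset.range (w.length + 1)).filter
      fun i => (0 :: w).getD i 0 = w.getD i 0).card = plat w := by
    rw [plat]
    congr 1
    ext i
    rw [Finset.mem_filter, Finset.mem_filter, Finset.mem_range, Finset.mem_Icc, entry, entry]
    rcases i with _ | i
    · simp only [List.getD_cons_zero]
      constructor
      · rintro ⟨-, h⟩; omega
      · rintro ⟨h, -⟩; omega
    · simp only [List.getD_cons_succ, Nat.add_sub_cancel]
      refine ⟨fun h => ⟨⟨by omega, ?_⟩, h.2⟩, fun h => ⟨by omega, h.2⟩⟩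
      rcases (Nat.lt_succ_iff.1 h.1).lt_or_eq with h' | h'
      · omega
      · rw [h', hl, show i = w.length - 1 by omega] at h; omega
  rw [weight_eq_prod, prod_step, hasc, hdes, hplat]

lemma quasiStirling_eq_words (k n : ℕ) : quasiStirling k n = words k (Finset.Icc 1 n) := by
  ext w
  simp [quasiStirling, words, avoids_iff_noncrossing]

lemma perms_eq_words (n : ℕ) : perms n = words 1 (Finset.Icc 1 n) := by
  ext w
  rw [mem_words, one_smul]
  simp only [perms, Multiset.mem_toFinset, Multiset.mem_lists_iff]
  refine ⟨fun h => ⟨h.symm, Noncrossing.of_nodup ?_⟩, fun h => h.1.symm⟩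
  rw [← Multiset.coe_nodup]
  have h' : (w : Multiset ℕ) = (Finset.Icc 1 n).val := h.symm
  exact h' ▸ (Finset.Icc 1 n).nodup

lemma weight_of_mem_words {k n : ℕ} (hk : k ≠ 0) (hn : n ≠ 0) {w : List ℕ}
    (hw : w ∈ words k (Finset.Icc 1 n)) : weight 0 w 0 = q ^ asc w * t ^ des w * u ^ plat w := by
  refine weight_eq_statistics ?_ fun x hx => ?_
  · rintro rfl
    have := congrArg (Multiset.count 1) (mem_words.1 hw).1
    rw [count_nsmul_val, if_pos (by simp; omega)] at this
    exact hk (by simpa using this.symm)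
  · have := mem_of_mem_words hw hx
    simp at this
    omega

lemma plat_eq_zero {w : List ℕ} (hw : w.Nodup) : plat w = 0 := by
  rw [plat, Finset.card_eq_zero, Finset.filter_eq_empty_iff]
  intro i hi h
  rw [Finset.mem_Icc] at hi
  rw [entry, entry, Nat.add_sub_cancel, List.getD_eq_getElem _ _ (by omega),
    List.getD_eq_getElem _ _ (by omega), hw.getElem_inj_iff] at h
  omega

noncomputable section

lemma quasiStirlingPoly_eq {k n : ℕ} (hk : k ≠ 0) (hn : n ≠ 0) :
    quasiStirlingPoly k n = stirlingSum k n := by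
  rw [quasiStirlingPoly, stirlingSum, wordSum, quasiStirling_eq_words]
  exact Finset.sum_congr rfl fun w hw => (weight_of_mem_words hk hn hw).symm

lemma eulerianHat_eq {n : ℕ} (hn : n ≠ 0) : eulerianHat n = eulerianSum n := by
  rw [eulerianHat, eulerianSum, wordSum, perms_eq_words]
  refine Finset.sum_congr rfl fun w hw => ?_
  have hnd : w.Nodup := by
    rw [← Multiset.coe_nodup, (mem_words.1 hw).1, one_smul]
    exact Finset.nodup _
  rw [weight_of_mem_words one_ne_zero hn hw, plat_eq_zero hnd, pow_zero, mul_one]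

lemma quasiStirlingPoly_zero (k : ℕ) : quasiStirlingPoly k 0 = 1 := by
  simp [quasiStirlingPoly, quasiStirling_eq_words, words_empty, asc, des, plat]

lemma eulerianHat_zero : eulerianHat 0 = 1 := by
  simp [eulerianHat, perms_eq_words, words_empty, asc, des]

lemma egf_eq_of_forall_pos {a b : ℕ → Poly} (h : ∀ n, n ≠ 0 → b n = a n) :
    egf b = egf a + C (b 0 - a 0) := by
  ext1 n
  rw [map_add, egf, egf, coeff_mk, coeff_mk, coeff_C]
  split_ifs with hn
  · subst hn; simp
  · rw [h n hn, add_zero]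

lemma Ahat_sub_one_add (p : Poly) :
    egf (fun j => if j = 0 then p else eulerianSum j) = Ahat - 1 + C p := by
  rw [Ahat, egf_eq_of_forall_pos (a := eulerianHat)
    (b := fun j => if j = 0 then p else eulerianSum j)
    fun n hn => by simp [hn, eulerianHat_eq hn], if_pos rfl, eulerianHat_zero, map_sub, map_one]
  ring

lemma Ahat_sub_one_add_u : Ahat - 1 + C u = egf eulerianSum := by
  rw [← Ahat_sub_one_add]
  congr 1
  ext1 j
  split_ifs with h
  · rw [h, eulerianSum_zero]
  · rfl

lemma Pbar_sub_one_add_u {k : ℕ} (hk : k ≠ 0) : Pbar k - 1 + C u = egf (stirlingSum k) := by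
  rw [Pbar, egf_eq_of_forall_pos (a := quasiStirlingPoly k) (b := stirlingSum k)
    fun n hn => (quasiStirlingPoly_eq hk hn).symm, quasiStirlingPoly_zero]
  have : stirlingSum k 0 = u := by simp [stirlingSum, wordSum_empty, step_self]
  rw [this, map_sub, map_one]
  ring

lemma constantCoeff_Ahat : constantCoeff Ahat = 1 := by
  rw [← coeff_zero_eq_constantCoeff_apply, Ahat, egf, coeff_mk, eulerianHat_zero]
  simp

lemma derivative_Ahat : d⁄dX Poly Ahat = (Ahat - 1 + C t) * (Ahat - 1 + C q) := by
  ext1 n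
  have hc : coeff (n + 1) Ahat = (1 / ((n + 1).factorial : ℚ)) • eulerianHat (n + 1) := by
    rw [Ahat, egf, coeff_mk]
  rw [coeff_derivative, hc, eulerianHat_eq n.succ_ne_zero, eulerianSum_succ,
    Ahat_sub_one_add, Ahat_sub_one_add, egfCoeff, smul_smul]
  have h : ((n : Poly) + 1) = algebraMap ℚ Poly (n + 1) := by simp
  rw [h, mul_comm, ← Algebra.smul_def, smul_smul, Nat.factorial_succ]
  have : ((n : ℚ) + 1) * (1 / (((n + 1) * n.factorial : ℕ) : ℚ) * (n.factorial : ℚ)) = 1 := by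
    have : (n.factorial : ℚ) ≠ 0 := by positivity
    push_cast
    field_simp
  rw [this, one_smul]

end

end QuasiStirling

namespace PowerSeries

section Substitution

variable {R : Type*} [CommRing R]

lemma hasSubst_X_mul (g : PowerSeries R) : HasSubst (X * g) :=
  HasSubst.of_constantCoeff_zero' (by simp)

lemma coeff_X_mul_pow (g : PowerSeries R) {n m : ℕ} (h : m ≤ n) :
    coeff n ((X * g) ^ m) = coeff (n - m) (g ^ m) := by
  rw [mul_pow, coeff_X_pow_mul', if_pos h]

lemma coeff_subst_X_mul (f g : PowerSeries R) (n : ℕ) :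
    coeff n (f.subst (X * g)) =
      ∑ m ∈ Finset.range (n + 1), coeff m f * coeff n ((X * g) ^ m) := by
  rw [coeff_subst' (hasSubst_X_mul g)]
  refine finsum_eq_sum_of_support_subset _ fun m hm => ?_
  by_contra h
  simp only [Finset.coe_range, Set.mem_Iio, not_lt] at h
  refine hm ?_
  simp only [smul_eq_mul]
  rw [mul_pow, coeff_X_pow_mul', if_neg (by omega), mul_zero]

lemma coeff_X_mul_derivative (f : PowerSeries R) (n : ℕ) :
    coeff n (X * d⁄dX R f) = n * coeff n f := by
  rcases n with _ | n
  · simp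
  · rw [coeff_succ_X_mul, coeff_derivative, mul_comm]
    push_cast
    rfl

lemma coeff_X_mul_derivative_mul (f g : PowerSeries R) (n : ℕ) :
    coeff n (X * d⁄dX R f * g) =
      ∑ j ∈ Finset.range (n + 1), j * coeff j f * coeff (n - j) g := by
  rw [coeff_mul, Finset.Nat.sum_antidiagonal_eq_sum_range_succ_mk]
  simp only [coeff_X_mul_derivative]

lemma add_one_mul_derivative_mul_pow (f : PowerSeries R) (n : ℕ) :
    ((n + 1 : ℕ) : PowerSeries R) * (d⁄dX R f * f ^ n) = d⁄dX R (f ^ (n + 1)) := by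
  rw [derivative_pow, Nat.add_sub_cancel]
  ring

lemma derivative_exp_subst_C_mul_X [Algebra ℚ R] (a : R) :
    d⁄dX R ((exp R).subst (C a * X : PowerSeries R)) =
      C a * (exp R).subst (C a * X : PowerSeries R) := by
  have hs : HasSubst (C a * X : PowerSeries R) := HasSubst.of_constantCoeff_zero' (by simp)
  rw [derivative_subst hs, derivative_exp]
  simp [mul_comm]

variable [IsDomain R] [CharZero R]

/-- **Lagrange inversion** for powers. -/
theorem lagrange_inversion_pow {φ g : PowerSeries R} (h : g = φ.subst (X * g)) (n m : ℕ)
    (hmn : m ≤ n) :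
    (n : R) * coeff n ((X * g) ^ m) = m * coeff (n - m) (φ ^ n) := by
  induction n using Nat.strong_induction_on generalizing m with
  | _ n ih =>
  rcases Nat.eq_zero_or_pos m with rfl | hm
  · rcases Nat.eq_zero_or_pos n with rfl | hn
    · simp
    · simp [coeff_one, hn.ne']
  have hg : coeff n ((X * g) ^ m) = coeff (n - m) ((φ ^ m).subst (X * g)) := by
    rw [coeff_X_mul_pow g hmn, subst_pow (hasSubst_X_mul g), ← h]
  rw [hg, coeff_subst_X_mul]
  obtain ⟨N, rfl⟩ := Nat.exists_eq_add_of_le hmn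
  rw [Nat.add_sub_cancel_left]
  rcases Nat.eq_zero_or_pos N with rfl | hN
  · simp
  have hN' : (N : R) ≠ 0 := Nat.cast_ne_zero.2 hN.ne'
  refine mul_left_cancel₀ hN' ?_
  have h1 : (N : R) * ∑ j ∈ Finset.range (N + 1), coeff j (φ ^ m) * coeff N ((X * g) ^ j) =
      coeff N (X * d⁄dX R (φ ^ m) * φ ^ N) := by
    rw [coeff_X_mul_derivative_mul, Finset.mul_sum]
    refine Finset.sum_congr rfl fun j hj => ?_
    rw [mul_left_comm, ih N (by omega) j (Nat.lt_succ_iff.1 (Finset.mem_range.1 hj))]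
    ring
  have h2 : (C ((m + N : ℕ) : R)) * (X * d⁄dX R (φ ^ m) * φ ^ N) =
      C (m : R) * (X * d⁄dX R (φ ^ (m + N))) := by
    rw [derivative_pow, derivative_pow, map_natCast, map_natCast,
      show m + N - 1 = (m - 1) + N by omega, pow_add]
    ring
  have h3 := congrArg (coeff N) h2
  rw [coeff_C_mul, coeff_C_mul, coeff_X_mul_derivative] at h3
  rw [mul_left_comm, h1, h3]
  ring

lemma coeff_of_eq_subst {Φ f : PowerSeries R} {r : ℕ} (h : f = Φ.subst (X * f ^ r)) {n : ℕ}
    (hn : n ≠ 0) : ((r * n + 1 : ℕ) : R) * coeff n f = coeff n (Φ ^ (r * n + 1)) := by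
  have hr : f ^ r = (Φ ^ r).subst (X * f ^ r) := by
    rw [subst_pow (hasSubst_X_mul _), ← h]
  refine mul_left_cancel₀ (Nat.cast_ne_zero.2 hn : (n : R) ≠ 0) ?_
  have h1 : (n : R) * coeff n f = coeff n (X * d⁄dX R Φ * Φ ^ (r * n)) := by
    conv_lhs => rw [h]
    rw [coeff_X_mul_derivative_mul, coeff_subst_X_mul, Finset.mul_sum]
    refine Finset.sum_congr rfl fun m hm => ?_
    rw [mul_left_comm, lagrange_inversion_pow hr n m (Nat.lt_succ_iff.1 (Finset.mem_range.1 hm)),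
      ← pow_mul]
    ring
  rw [mul_left_comm, h1, ← coeff_X_mul_derivative, ← add_one_mul_derivative_mul_pow,
    ← coeff_C_mul, map_natCast]
  congr 1
  ring

lemma eq_zero_of_derivative_eq_mul {w y : PowerSeries R} (h : d⁄dX R w = y * w)
    (h0 : constantCoeff w = 0) : w = 0 := by
  ext1 n
  rw [map_zero]
  induction n using Nat.strong_induction_on with
  | _ n ih =>
  rcases n with _ | n
  · simpa using h0
  · have h1 := congrArg (coeff n) h
    rw [coeff_derivative, coeff_mul, Finset.sum_eq_zero] at h1
    · have : ((n : R) + 1) ≠ 0 := by exact_mod_cast n.succ_ne_zero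
      exact (mul_eq_zero.1 h1).resolve_right this
    · intro p hp
      have := Finset.HasAntidiagonal.mem_antidiagonal.1 hp
      rw [ih p.2 (by omega), mul_zero]

/-- The solution of a Riccati equation. -/
lemma riccati_solution [Algebra ℚ R] {y : PowerSeries R} {a b : R}
    (hy : d⁄dX R y = y * (y - C (a - b))) (h0 : constantCoeff y = a) :
    y * (C a - C b * (exp R).subst (C (a - b) * X : PowerSeries R)) = C (a * (a - b)) := by
  rw [← sub_eq_zero]
  have hs : HasSubst (C (a - b) * X : PowerSeries R) := HasSubst.of_constantCoeff_zero' (by simp)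
  refine eq_zero_of_derivative_eq_mul (y := y) ?_ ?_
  · rw [map_sub, Derivation.leibniz, map_sub, Derivation.leibniz, derivative_exp_subst_C_mul_X, hy]
    simp only [derivative_C, smul_eq_mul, mul_zero, add_zero, zero_sub, sub_zero]
    simp only [map_sub, map_mul]
    ring
  · have : constantCoeff ((exp R).subst (C (a - b) * X : PowerSeries R)) = 1 := by
      rw [mul_comm, ← coeff_zero_eq_constantCoeff_apply, coeff_subst_X_mul]
      simp
    rw [map_sub, map_mul, map_sub, map_mul, this, h0]
    simp

end Substitution

end PowerSeries

namespace QuasiStirling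

noncomputable section

lemma egf_stirlingSum_eq_subst (r : ℕ) :
    egf (stirlingSum (r + 1)) =
      (egf eulerianSum).subst (X * egf (stirlingSum (r + 1)) ^ r : PowerSeries Poly) := by
  ext1 n
  rw [coeff_subst_X_mul]
  have h : coeff n (egf (stirlingSum (r + 1))) = (1 / (n.factorial : ℚ)) • stirlingSum (r + 1) n := by
    rw [egf, coeff_mk]
  rw [h, stirlingSum_eq, Finset.smul_sum]
  refine Finset.sum_congr rfl fun j hj => ?_
  have hj : j ≤ n := Nat.lt_succ_iff.1 (Finset.mem_range.1 hj)
  have h' : coeff j (egf eulerianSum) = (1 / (j.factorial : ℚ)) • eulerianSum j := by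
    rw [egf, coeff_mk]
  rw [coeff_X_mul_pow _ hj, h', egfCoeff, ← Nat.cast_smul_eq_nsmul ℚ, smul_smul, mul_smul_comm,
    smul_smul, smul_mul_assoc]
  congr 1
  rw [← Nat.choose_mul_factorial_mul_factorial hj]
  have h1 : (j.factorial : ℚ) ≠ 0 := by positivity
  have h2 : ((n - j).factorial : ℚ) ≠ 0 := by positivity
  have h3 : (n.choose j : ℚ) ≠ 0 := by exact_mod_cast (Nat.choose_pos hj).ne'
  push_cast
  field_simp

lemma Pbar_eq_subst (r : ℕ) :
    Pbar (r + 1) = Ahat.subst (X * (Pbar (r + 1) - 1 + C u) ^ r : PowerSeries Poly) := by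
  have hA : Ahat = egf eulerianSum + C (1 - u) := by
    rw [← Ahat_sub_one_add_u, map_sub, map_one]; ring
  have hP : Pbar (r + 1) = egf (stirlingSum (r + 1)) + C (1 - u) := by
    rw [← Pbar_sub_one_add_u r.succ_ne_zero, map_sub, map_one]; ring
  rw [Pbar_sub_one_add_u r.succ_ne_zero, hA, subst_add (hasSubst_X_mul _),
    ← egf_stirlingSum_eq_subst, hP, subst_C]
  rfl

lemma Ahat_explicit :
    (PowerSeries.map (algebraMap Poly RatFun) Ahat - 1 + const q) *
      (const q - const t * (exp RatFun).subst (const (q - t) * X : PowerSeries RatFun)) =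
        const (q * (q - t)) := by
  have h := riccati_solution (R := RatFun)
    (y := PowerSeries.map (algebraMap Poly RatFun) Ahat - 1 + const q)
    (a := algebraMap Poly RatFun q) (b := algebraMap Poly RatFun t) ?_ ?_
  · simpa only [const, map_mul, map_sub] using h
  · have hd : d⁄dX RatFun (PowerSeries.map (algebraMap Poly RatFun) Ahat) =
        PowerSeries.map (algebraMap Poly RatFun) (d⁄dX Poly Ahat) := by
      ext n
      simp [coeff_derivative]
    rw [map_add, map_sub, hd, derivative_Ahat]
    simp [const]
    ring
  · have h1 : constantCoeff (PowerSeries.map (algebraMap Poly RatFun) Ahat) = 1 := by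
      rw [← coeff_zero_eq_constantCoeff_apply, coeff_map, coeff_zero_eq_constantCoeff_apply,
        constantCoeff_Ahat, map_one]
    simp [const, h1]

end

end QuasiStirling

theorem theorem4p5 (k : ℕ) (hk : 1 ≤ k) :
    -- the implicit equation
    QuasiStirling.Pbar k =
        QuasiStirling.Ahat.subst
          (PowerSeries.X *
            (QuasiStirling.Pbar k - 1 + PowerSeries.C QuasiStirling.u) ^ (k - 1) :
              PowerSeries QuasiStirling.Poly) ∧
    -- its explicit form; the inverted series has constant coefficient `q - t ≠ 0`
    QuasiStirling.PbarRat k =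
        1 - QuasiStirling.const QuasiStirling.q +
          QuasiStirling.const (QuasiStirling.q * (QuasiStirling.q - QuasiStirling.t)) *
            (QuasiStirling.const QuasiStirling.q - QuasiStirling.const QuasiStirling.t *
              (PowerSeries.exp QuasiStirling.RatFun).subst
                (QuasiStirling.const (QuasiStirling.q - QuasiStirling.t) * PowerSeries.X *
                  (QuasiStirling.PbarRat k - 1 + QuasiStirling.const QuasiStirling.u) ^ (k - 1) :
                    PowerSeries QuasiStirling.RatFun))⁻¹ ∧
    -- the coefficients
    ∀ n : ℕ, 1 ≤ n →
      QuasiStirling.quasiStirlingPoly k n =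
        ((n.factorial : ℚ) / (((k - 1) * n + 1 : ℕ) : ℚ)) •
          PowerSeries.coeff n
            ((QuasiStirling.Ahat - 1 + PowerSeries.C QuasiStirling.u) ^ ((k - 1) * n + 1)) := by
  obtain ⟨r, rfl⟩ : ∃ r, k = r + 1 := ⟨k - 1, by omega⟩
  rw [Nat.add_sub_cancel]
  refine ⟨QuasiStirling.Pbar_eq_subst r, ?_, fun n hn => ?_⟩
  · set g : PowerSeries QuasiStirling.RatFun :=
      (QuasiStirling.PbarRat (r + 1) - 1 + QuasiStirling.const QuasiStirling.u) ^ r with hg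
    have hs := PowerSeries.hasSubst_X_mul g
    have hP : QuasiStirling.PbarRat (r + 1) =
        (PowerSeries.map (algebraMap QuasiStirling.Poly QuasiStirling.RatFun)
          QuasiStirling.Ahat).subst (PowerSeries.X * g) := by
      have h := congrArg (PowerSeries.map (algebraMap QuasiStirling.Poly QuasiStirling.RatFun))
        (QuasiStirling.Pbar_eq_subst r)
      have h' := PowerSeries.map_subst (PowerSeries.hasSubst_X_mul
        ((QuasiStirling.Pbar (r + 1) - 1 + PowerSeries.C QuasiStirling.u) ^ r))
        (h := algebraMap QuasiStirling.Poly QuasiStirling.RatFun) QuasiStirling.Ahat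
      have hX : PowerSeries.map (algebraMap QuasiStirling.Poly QuasiStirling.RatFun)
          (PowerSeries.X * (QuasiStirling.Pbar (r + 1) - 1 + PowerSeries.C QuasiStirling.u) ^ r) =
            PowerSeries.X * g := by
        simp [hg, QuasiStirling.PbarRat, QuasiStirling.const]
      rw [← hX]
      exact h.trans h'
    have hE := congrArg (PowerSeries.subst (PowerSeries.X * g)) QuasiStirling.Ahat_explicit
    have hl : PowerSeries.HasSubst (QuasiStirling.const (QuasiStirling.q - QuasiStirling.t) *
        PowerSeries.X : PowerSeries QuasiStirling.RatFun) :=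
      PowerSeries.HasSubst.of_constantCoeff_zero' (by simp)
    have hC : ∀ p, (QuasiStirling.const p).subst (PowerSeries.X * g) = QuasiStirling.const p :=
      fun p => PowerSeries.subst_C _
    have h1 : (1 : PowerSeries QuasiStirling.RatFun).subst (PowerSeries.X * g) =
        (1 : PowerSeries QuasiStirling.RatFun) := by
      rw [← PowerSeries.coe_substAlgHom hs, map_one]
    rw [PowerSeries.subst_mul hs, PowerSeries.subst_add hs, PowerSeries.subst_sub hs,
      PowerSeries.subst_sub hs, PowerSeries.subst_mul hs, PowerSeries.subst_comp_subst_apply hl hs,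
      PowerSeries.subst_mul hs, PowerSeries.subst_X hs, hC, hC, hC, hC, h1, ← hP, ← mul_assoc] at hE
    have hconst : PowerSeries.constantCoeff (QuasiStirling.const QuasiStirling.q -
        QuasiStirling.const QuasiStirling.t * (PowerSeries.exp QuasiStirling.RatFun).subst
          (QuasiStirling.const (QuasiStirling.q - QuasiStirling.t) * PowerSeries.X * g)) ≠ 0 := by
      have he : PowerSeries.constantCoeff ((PowerSeries.exp QuasiStirling.RatFun).subst
          (QuasiStirling.const (QuasiStirling.q - QuasiStirling.t) * PowerSeries.X * g)) = 1 := by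
        rw [mul_comm _ PowerSeries.X, mul_assoc,
          ← PowerSeries.coeff_zero_eq_constantCoeff_apply, PowerSeries.coeff_subst_X_mul]
        simp
      rw [map_sub, map_mul, he, mul_one]
      simp only [QuasiStirling.const, PowerSeries.constantCoeff_C]
      rw [sub_ne_zero, (IsFractionRing.injective QuasiStirling.Poly QuasiStirling.RatFun).ne_iff]
      exact (MvPolynomial.X_injective (σ := Fin 3) (R := ℚ)).ne (by decide)
    rw [← (PowerSeries.eq_mul_inv_iff_mul_eq hconst).2 hE]
    ring
  · have h := PowerSeries.coeff_of_eq_subst (QuasiStirling.egf_stirlingSum_eq_subst r)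
      (n := n) (by omega)
    rw [QuasiStirling.Ahat_sub_one_add_u, ← h,
      QuasiStirling.quasiStirlingPoly_eq r.succ_ne_zero (by omega),
      ← QuasiStirling.egfCoeff_egf (QuasiStirling.stirlingSum (r + 1)) n, QuasiStirling.egfCoeff,
      ← nsmul_eq_mul, ← Nat.cast_smul_eq_nsmul ℚ, smul_smul,
      div_mul_cancel₀ _ (by positivity : (((r * n + 1 : ℕ) : ℚ)) ≠ 0)]
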